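/- Let $d\ge 0$ be an integer and let $K\subset\mathbf{R}^d$ be a $d$-dimensional convex body, that is, a compact convex set with non-empty interior. Write $\mu$ for Lebesgue measure and $K-K=\{x-y : x,y\in K\}$ for the difference body of $K$. Let \[ C(K):=\inf\left\{\sum_{i=1}^n(1-\lambda_i)^{-1} : n\in\mathbf{N},\ 0<\lambda_i<1,\ t_i\in\mathbf{R}^d,\ K\subseteq\bigcup_{i=1}^n(\lambda_iK+t_i)\right\}, \] and let $\vartheta(K)$ be the translative covering density of $K$, that is, the infimum, over all sets $X\subseteq\mathbf{R}^d$ with $\bigcup_{x\in X}(K+x)=\mathbf{R}^d$, of the lower density \[ \liminf_{r\to\infty}\ \frac{1}{\mu(B_r)}\sum_{x\in X,\ K+x\subseteq B_r}\mu(K+x), \] where $B_r$ is the Euclidean ball of radius $r$ centred at the origin. Then $\vartheta(K)$ is finite and \[ C(K) < e\,(d+1)\,\frac{\mu(K-K)}{\mu(K)}\,\vartheta(K). \] -/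

import Mathlib

open MeasureTheory Filter
open scoped ENNReal Pointwise

noncomputable section

/-- The quantitative covering parameter `C(K)`: the infimum of `∑ i, (1 - lam i)⁻¹` over all finite
families of positive homothets `lam i • K + t i`, with `0 < lam i < 1`, whose union contains `K`.
(Each summand exceeds `1`, so infinite families would only contribute the value `∞`.) -/
def coveringParam {d : ℕ} (K : Set (EuclideanSpace ℝ (Fin d))) : ℝ≥0∞ :=
  ⨅ (n : ℕ) (lam : Fin n → ℝ) (t : Fin n → EuclideanSpace ℝ (Fin d))
    (_ : ∀ i, 0 < lam i ∧ lam i < 1) (_ : K ⊆ ⋃ i, (t i +ᵥ (lam i • K))),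
      ENNReal.ofReal (∑ i, (1 - lam i)⁻¹)

/-- `X` is the set of translation vectors of a covering of the whole space by translates of `K`. -/
def IsTranslativeCovering {d : ℕ} (K X : Set (EuclideanSpace ℝ (Fin d))) : Prop :=
  ⋃ x ∈ X, (x +ᵥ K) = Set.univ

/-- The density of the system `{x + K : x ∈ X}` in the ball of radius `r` about the origin: the
total volume of the translates contained in the ball, divided by the volume of the ball. -/
def densityInBall {d : ℕ} (K X : Set (EuclideanSpace ℝ (Fin d))) (r : ℝ) : ℝ≥0∞ :=
  (∑' x : {x : EuclideanSpace ℝ (Fin d) | x ∈ X ∧ x +ᵥ K ⊆ Metric.closedBall 0 r},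
      volume (x.1 +ᵥ K)) / volume (Metric.closedBall (0 : EuclideanSpace ℝ (Fin d)) r)

/-- The lower density of the system `{x + K : x ∈ X}`. -/
def lowerDensity {d : ℕ} (K X : Set (EuclideanSpace ℝ (Fin d))) : ℝ≥0∞ :=
  liminf (fun r : ℝ => densityInBall K X r) atTop

/-- The translative covering density of `K`: the infimum of the lower densities of all coverings of
the space by translates of `K`. -/
def translativeCoveringDensity {d : ℕ} (K : Set (EuclideanSpace ℝ (Fin d))) : ℝ≥0∞ :=
  ⨅ (X : Set (EuclideanSpace ℝ (Fin d))) (_ : IsTranslativeCovering K X), lowerDensity K X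

end

/-!
Only families of homothets with one common ratio `lam` are needed. Covering `K` by `N` translates of
`lam • K` amounts to covering `M = lam⁻¹ • K` by `N` translates of `K`, and it costs
`N * (1 - lam)⁻¹`. A covering `X` of the space by translates of `K` supplies such families: for each
`s`, the translate `s + M` is covered by those `x + K` with `x ∈ X` and `x - s ∈ M - K`. Averaging
the number of such `x` over `s` in a ball (`coveringParam_mul_volume_le`) and letting the radius
tend to infinity (`coveringParam_mul_volume_le_lowerDensity`) shows that some `N` is at most
`volume (M - K) / volume K` times the lower density of `X`. By convexity a translate of `lam • K`
lies in `K`, so `volume (M - K) ≤ lam⁻¹ ^ d * volume (K - K)` (`volume_inv_smul_sub_le`). The choice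
`lam = d / (d + 1)` gives the factor `(d + 1) * (1 + 1 / d) ^ d < e * (d + 1)`.

Strictness survives multiplication by the other factors because the covering density is neither
infinite, as the translates indexed by a maximal separated set form a covering of finite density
(`exists_isTranslativeCovering_lowerDensity_lt_top`), nor zero, as the covering parameter is at
least `1` (`one_le_coveringParam`).
-/

/-! ### The homothety ratio -/

/-- The ratio is `d / (d + 1)` for `d ≥ 1`; in dimension `0`, where this vanishes, `1 / 2` works
because `2 < e`. -/
theorem exists_ratio_lt_exp_mul (d : ℕ) :
    ∃ lam : ℝ, 0 < lam ∧ lam < 1 ∧ (1 - lam)⁻¹ * lam⁻¹ ^ d < Real.exp 1 * (d + 1) := by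
  rcases Nat.eq_zero_or_pos d with rfl | hd
  · refine ⟨1 / 2, by norm_num, by norm_num, ?_⟩
    have := Real.exp_one_gt_d9
    norm_num
    linarith
  · have hd' : (0 : ℝ) < d := by exact_mod_cast hd
    refine ⟨d / (d + 1), by positivity, by rw [div_lt_one (by positivity)]; linarith, ?_⟩
    have h1 : (1 - (d : ℝ) / (d + 1))⁻¹ = d + 1 := by
      have : (1 - (d : ℝ) / (d + 1)) = (d + 1 : ℝ)⁻¹ := by field_simp; ring
      rw [this, inv_inv]
    have h2 : ((d : ℝ) / (d + 1))⁻¹ = (d : ℝ)⁻¹ + 1 := by field_simp; ring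
    have h3 : ((d : ℝ)⁻¹ + 1) ^ d < Real.exp 1 := by
      have h := Real.add_one_lt_exp (x := (d : ℝ)⁻¹) (by positivity)
      calc ((d : ℝ)⁻¹ + 1) ^ d < Real.exp (d : ℝ)⁻¹ ^ d :=
            pow_lt_pow_left₀ h (by positivity) hd.ne'
        _ = Real.exp 1 := by
            rw [← Real.exp_nat_mul, mul_inv_cancel₀ hd'.ne']
    rw [h1, h2, mul_comm]
    gcongr

/-! ### Bounds for the covering parameter -/

theorem one_le_coveringParam {d : ℕ} {K : Set (EuclideanSpace ℝ (Fin d))} (hK : K.Nonempty) :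
    1 ≤ coveringParam K := by
  refine le_iInf fun n => le_iInf fun lam => le_iInf fun t => le_iInf fun hl => le_iInf fun hc => ?_
  obtain ⟨k, hk⟩ := hK
  obtain ⟨i, -⟩ := Set.mem_iUnion.1 (hc hk)
  rw [ENNReal.one_le_ofReal]
  have hpos : ∀ j, 0 < 1 - lam j := fun j => by linarith [(hl j).2]
  calc (1 : ℝ) ≤ (1 - lam i)⁻¹ := (one_le_inv₀ (hpos i)).2 (by linarith [(hl i).1])
    _ ≤ ∑ j, (1 - lam j)⁻¹ := Finset.single_le_sum (f := fun j => (1 - lam j)⁻¹)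
        (fun j _ => (inv_pos.2 (hpos j)).le) (Finset.mem_univ i)

/-- A covering of a translate of `lam⁻¹ • K` by translates of `K`, rescaled by `lam`, competes in the
infimum defining `coveringParam K`. -/
theorem coveringParam_le_card_mul {d : ℕ} {K : Set (EuclideanSpace ℝ (Fin d))} {lam : ℝ}
    (h0 : 0 < lam) (h1 : lam < 1) (F : Finset (EuclideanSpace ℝ (Fin d)))
    (s : EuclideanSpace ℝ (Fin d)) (hF : s +ᵥ (lam⁻¹ • K) ⊆ ⋃ x ∈ F, (x +ᵥ K)) :
    coveringParam K ≤ F.card * ENNReal.ofReal (1 - lam)⁻¹ := by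
  refine (iInf_le _ F.card).trans <| (iInf_le _ fun _ => lam).trans <|
    (iInf_le _ fun i => lam • ((F.equivFin.symm i : EuclideanSpace ℝ (Fin d)) - s)).trans <|
    (iInf_le _ fun _ => ⟨h0, h1⟩).trans <| (iInf_le _ ?_).trans ?_
  · intro k hk
    obtain ⟨x, hx, k', hk', hxk⟩ := Set.mem_iUnion₂.1
      (hF (Set.vadd_mem_vadd_set (Set.smul_mem_smul_set hk)))
    refine Set.mem_iUnion.2 ⟨F.equivFin ⟨x, hx⟩, lam • k', Set.smul_mem_smul_set hk', ?_⟩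
    simp only [vadd_eq_add, Equiv.symm_apply_apply] at hxk ⊢
    have : k' = s + lam⁻¹ • k - x := by rw [← hxk]; abel
    rw [this, smul_sub, smul_sub, smul_add, smul_inv_smul₀ h0.ne']
    abel
  · rw [Finset.sum_const, Finset.card_univ, Fintype.card_fin, nsmul_eq_mul,
      ENNReal.ofReal_mul (by positivity), ENNReal.ofReal_natCast]

/-! ### Averaging over a ball -/

/-- The averaging argument. The number of `x ∈ X` with `x - s ∈ lam⁻¹ • K - K`, integrated over `s`
in the ball of radius `R`, bounds the left side from above once multiplied by `(1 - lam)⁻¹`; each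
`x` contributes at most `volume (lam⁻¹ • K - K)` to it. The constant `D` is such that every
translate `x + K` which occurs lies in the ball of radius `R + D`. -/
theorem coveringParam_mul_volume_le {d : ℕ} {K X : Set (EuclideanSpace ℝ (Fin d))}
    (hK : IsCompact K) (hvol : volume K ≠ 0) (hX : IsTranslativeCovering K X) {lam : ℝ}
    (h0 : 0 < lam) (h1 : lam < 1) :
    ∃ D : ℝ, 0 ≤ D ∧ ∀ R : ℝ,
      coveringParam K * volume (Metric.closedBall (0 : EuclideanSpace ℝ (Fin d)) R) * volume K ≤
        ENNReal.ofReal (1 - lam)⁻¹ * volume (lam⁻¹ • K - K) *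
          ∑' x : {x : EuclideanSpace ℝ (Fin d) |
            x ∈ X ∧ x +ᵥ K ⊆ Metric.closedBall 0 (R + D)}, volume (x.1 +ᵥ K) := by
  have hM : IsCompact (lam⁻¹ • K) := hK.smul _
  have hA : IsCompact (lam⁻¹ • K - K) := sub_eq_add_neg (lam⁻¹ • K) K ▸ hM.add hK.neg
  have hKne : K.Nonempty := nonempty_of_measure_ne_zero hvol
  have ha : ENNReal.ofReal (1 - lam)⁻¹ ≠ 0 := by
    rw [Ne, ENNReal.ofReal_eq_zero, not_le]
    exact inv_pos.2 (by linarith)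
  have hAvol : volume (lam⁻¹ • K - K) ≠ 0 := by
    obtain ⟨k, hk⟩ := hKne
    have hsub : (lam⁻¹ • k) +ᵥ (-K) ⊆ lam⁻¹ • K - K := by
      rintro _ ⟨y, hy, rfl⟩
      exact ⟨lam⁻¹ • k, Set.smul_mem_smul_set hk, -y, hy, by simp⟩
    intro h
    have := measure_mono_null hsub h
    rw [measure_vadd, Measure.measure_neg] at this
    exact hvol this
  obtain ⟨m, hm⟩ := hA.isBounded.exists_norm_le
  obtain ⟨k, hk⟩ := hK.isBounded.exists_norm_le
  refine ⟨max (m + k) 0, le_max_right _ _, fun R => ?_⟩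
  set G := {x : EuclideanSpace ℝ (Fin d) |
    x ∈ X ∧ x +ᵥ K ⊆ Metric.closedBall 0 (R + max (m + k) 0)}
  simp only [measure_vadd, ENNReal.tsum_const]
  rcases G.finite_or_infinite with hfin | hinf
  swap
  -- Infinitely many translates in the ball make the right side infinite.
  · have := hinf.to_subtype
    rw [ENat.card_eq_top_of_infinite]
    simp [ENNReal.mul_top, ENNReal.top_mul, ha, hAvol, hvol]
  classical
  have hcard : ((ENat.card G : ℕ∞) : ℝ≥0∞) = hfin.toFinset.card := by
    rw [ENat.card_coe_set_eq, hfin.encard_eq_coe_toFinset_card, ENat.toENNReal_coe]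
  rw [hcard, ← mul_assoc]
  gcongr ?_ * _
  -- The points `s` for which the translates `x + K` and `s + lam⁻¹ • K` meet.
  let T : EuclideanSpace ℝ (Fin d) → Set (EuclideanSpace ℝ (Fin d)) :=
    fun x => {s | x - s ∈ lam⁻¹ • K - K}
  have hTm : ∀ x, MeasurableSet (T x) := fun x =>
    (hA.isClosed.preimage (by fun_prop : Continuous fun s => x - s)).measurableSet
  have hTvol : ∀ x, volume (T x) = volume (lam⁻¹ • K - K) := fun x =>
    (Measure.measurePreserving_sub_left volume x).measure_preimage
      hA.isClosed.measurableSet.nullMeasurableSet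
  have hpt : ∀ s ∈ Metric.closedBall (0 : EuclideanSpace ℝ (Fin d)) R, coveringParam K ≤
      ∑ x ∈ hfin.toFinset, (T x).indicator (fun _ => ENNReal.ofReal (1 - lam)⁻¹) s := by
    intro s hs
    have hcov : s +ᵥ (lam⁻¹ • K) ⊆ ⋃ x ∈ hfin.toFinset.filter (fun x => s ∈ T x), (x +ᵥ K) := by
      rintro _ ⟨y, hy, rfl⟩
      have hy' : s +ᵥ y ∈ ⋃ x ∈ X, (x +ᵥ K) := by
        rw [show ⋃ x ∈ X, (x +ᵥ K) = Set.univ from hX]; trivial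
      obtain ⟨x, hx, z, hz, hxz⟩ := Set.mem_iUnion₂.1 hy'
      simp only [vadd_eq_add] at hxz
      have hxs : x - s ∈ lam⁻¹ • K - K :=
        ⟨y, hy, z, hz, by rw [sub_eq_sub_iff_add_eq_add, add_comm y, hxz]⟩
      refine Set.mem_iUnion₂.2 ⟨x, ?_, z, hz, hxz⟩
      rw [Finset.mem_filter, Set.Finite.mem_toFinset]
      refine ⟨⟨hx, ?_⟩, hxs⟩
      rintro _ ⟨w, hw, rfl⟩
      rw [mem_closedBall_zero_iff] at hs ⊢
      have e : x +ᵥ w = s + (x - s) + w := by simp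
      change ‖x +ᵥ w‖ ≤ _
      rw [e]
      calc ‖s + (x - s) + w‖ ≤ ‖s‖ + ‖x - s‖ + ‖w‖ := norm_add₃_le
        _ ≤ R + m + k := by gcongr; exacts [hm _ hxs, hk _ hw]
        _ ≤ R + max (m + k) 0 := by linarith [le_max_left (m + k) 0]
    refine (coveringParam_le_card_mul h0 h1 _ s hcov).trans_eq ?_
    simp only [Set.indicator_apply]
    rw [← Finset.sum_filter, Finset.sum_const, nsmul_eq_mul]
  calc coveringParam K * volume (Metric.closedBall (0 : EuclideanSpace ℝ (Fin d)) R)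
      = ∫⁻ _ in Metric.closedBall (0 : EuclideanSpace ℝ (Fin d)) R, coveringParam K := by
        rw [setLIntegral_const]
    _ ≤ ∫⁻ s in Metric.closedBall (0 : EuclideanSpace ℝ (Fin d)) R,
          ∑ x ∈ hfin.toFinset, (T x).indicator (fun _ => ENNReal.ofReal (1 - lam)⁻¹) s :=
        setLIntegral_mono' Metric.isClosed_closedBall.measurableSet hpt
    _ ≤ ∫⁻ s, ∑ x ∈ hfin.toFinset, (T x).indicator (fun _ => ENNReal.ofReal (1 - lam)⁻¹) s :=
        setLIntegral_le_lintegral _ _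
    _ = ENNReal.ofReal (1 - lam)⁻¹ * volume (lam⁻¹ • K - K) * hfin.toFinset.card := by
        rw [lintegral_finsetSum _ fun x _ => measurable_const.indicator (hTm x)]
        simp only [lintegral_indicator_const (hTm _), hTvol, Finset.sum_const, nsmul_eq_mul]
        rw [mul_comm]

/-- As `r → ∞` the balls of radii `r - D` and `r` have asymptotically equal volumes, so the averaging
inequality passes to the lower density. -/
theorem coveringParam_mul_volume_le_lowerDensity {d : ℕ} {K X : Set (EuclideanSpace ℝ (Fin d))}
    (hK : IsCompact K) (hvol : volume K ≠ 0) (hX : IsTranslativeCovering K X) {lam : ℝ}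
    (h0 : 0 < lam) (h1 : lam < 1) :
    coveringParam K * volume K ≤
      ENNReal.ofReal (1 - lam)⁻¹ * volume (lam⁻¹ • K - K) * lowerDensity K X := by
  obtain ⟨D, hD, h⟩ := coveringParam_mul_volume_le hK hvol hX h0 h1
  set B := ENNReal.ofReal (1 - lam)⁻¹ * volume (lam⁻¹ • K - K) with hB
  have hcpt : IsCompact (lam⁻¹ • K - K) :=
    sub_eq_add_neg (lam⁻¹ • K) K ▸ (hK.smul lam⁻¹).add hK.neg
  have hBtop : B ≠ ∞ :=
    ENNReal.mul_ne_top ENNReal.ofReal_ne_top hcpt.measure_lt_top.ne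
  -- The inequality at radius `r`, divided by the volume of the ball.
  have hr : ∀ r : ℝ, D < r →
      coveringParam K * volume K * ENNReal.ofReal (((r - D) / r) ^ d) ≤ B * densityInBall K X r := by
    intro r hr
    have hr0 : 0 < r := hD.trans_lt hr
    have hball : ∀ ρ : ℝ, 0 ≤ ρ → volume (Metric.closedBall (0 : EuclideanSpace ℝ (Fin d)) ρ) =
        ENNReal.ofReal (ρ ^ d) * volume (Metric.ball (0 : EuclideanSpace ℝ (Fin d)) 1) := by
      intro ρ hρ
      rw [Measure.addHaar_closedBall _ _ hρ, finrank_euclideanSpace_fin]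
    have hb0 : volume (Metric.closedBall (0 : EuclideanSpace ℝ (Fin d)) r) ≠ 0 :=
      (Metric.measure_closedBall_pos volume _ hr0).ne'
    have hbt : volume (Metric.closedBall (0 : EuclideanSpace ℝ (Fin d)) r) ≠ ∞ :=
      measure_closedBall_lt_top.ne
    have hq : ENNReal.ofReal (((r - D) / r) ^ d) *
        volume (Metric.closedBall (0 : EuclideanSpace ℝ (Fin d)) r) =
        volume (Metric.closedBall (0 : EuclideanSpace ℝ (Fin d)) (r - D)) := by
      rw [hball r hr0.le, hball (r - D) (by linarith), ← mul_assoc,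
        ← ENNReal.ofReal_mul (by have := sub_pos.2 hr; positivity), ← mul_pow,
        div_mul_cancel₀ _ hr0.ne']
    have := h (r - D)
    rw [sub_add_cancel] at this
    rw [densityInBall, ← mul_div_assoc, ENNReal.le_div_iff_mul_le (.inl hb0) (.inl hbt), mul_assoc,
      hq]
    calc _ = coveringParam K * volume (Metric.closedBall 0 (r - D)) * volume K := by ring
      _ ≤ _ := this
  have hlim : Tendsto (fun r : ℝ => coveringParam K * volume K *
      ENNReal.ofReal (((r - D) / r) ^ d)) atTop (nhds (coveringParam K * volume K)) := by
    have h1 : Tendsto (fun r : ℝ => ((r - D) / r) ^ d) atTop (nhds 1) := by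
      have h2 : Tendsto (fun r : ℝ => (1 - D / r) ^ d) atTop (nhds ((1 - 0) ^ d)) :=
        (tendsto_const_nhds.sub (tendsto_const_nhds.div_atTop tendsto_id)).pow d
      rw [sub_zero, one_pow] at h2
      refine h2.congr' ?_
      filter_upwards [eventually_gt_atTop 0] with r hr
      rw [sub_div, div_self hr.ne']
    have h2 := ENNReal.tendsto_ofReal h1
    rw [ENNReal.ofReal_one] at h2
    have := ENNReal.Tendsto.const_mul (a := coveringParam K * volume K) h2 (.inl one_ne_zero)
    rwa [mul_one] at this
  calc coveringParam K * volume K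
      = liminf (fun r : ℝ => coveringParam K * volume K *
          ENNReal.ofReal (((r - D) / r) ^ d)) atTop := hlim.liminf_eq.symm
    _ ≤ liminf (fun r => B * densityInBall K X r) atTop :=
        liminf_le_liminf ((eventually_gt_atTop D).mono hr)
    _ = B * lowerDensity K X := ENNReal.liminf_const_mul_of_ne_top hBtop

/-- For `p ∈ K`, convexity gives `lam • K ⊆ K - (1 - lam) • p`. -/
theorem volume_inv_smul_sub_le {d : ℕ} {K : Set (EuclideanSpace ℝ (Fin d))} (hK : Convex ℝ K)
    (hne : K.Nonempty) {lam : ℝ} (h0 : 0 < lam) (h1 : lam < 1) :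
    volume (lam⁻¹ • K - K) ≤ ENNReal.ofReal (lam⁻¹ ^ d) * volume (K - K) := by
  obtain ⟨p, hp⟩ := hne
  have hsub : lam⁻¹ • K - K ⊆ lam⁻¹ • (((1 - lam) • p) +ᵥ (K - K)) := by
    rintro _ ⟨_, ⟨x, hx, rfl⟩, y, hy, rfl⟩
    refine ⟨x - lam • y, ⟨x - ((1 - lam) • p + lam • y), ⟨x, hx, _,
      hK hp hy (by linarith) h0.le (by ring), rfl⟩, ?_⟩, ?_⟩
    · simp only [vadd_eq_add]; abel
    · simp only [smul_sub, inv_smul_smul₀ h0.ne']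
  refine (measure_mono hsub).trans_eq ?_
  rw [Measure.addHaar_smul_of_nonneg _ (inv_nonneg.2 h0.le), finrank_euclideanSpace_fin,
    measure_vadd]

/-! ### Finiteness of the covering density -/

/-- If `K` contains the ball of radius `ρ` about `p`, take for `X` a maximal set of points at
pairwise distances at least `ρ`. The translates `x + K` cover the space by maximality, and they
contain the pairwise disjoint balls of radius `ρ / 2` about the points `x + p`, which bounds their
total volume inside any ball. -/
theorem exists_isTranslativeCovering_lowerDensity_lt_top {d : ℕ}
    {K : Set (EuclideanSpace ℝ (Fin d))} (hK : IsCompact K) (hint : (interior K).Nonempty) :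
    ∃ X, IsTranslativeCovering K X ∧ lowerDensity K X < ∞ := by
  obtain ⟨p, hp⟩ := hint
  obtain ⟨ρ, hρ, hρK⟩ := Metric.mem_nhds_iff.1 (mem_interior_iff_mem_nhds.1 hp)
  obtain ⟨X, hX⟩ : ∃ X : Set (EuclideanSpace ℝ (Fin d)),
      Maximal (fun X => X.Pairwise fun x y => ρ ≤ dist x y) X := by
    obtain ⟨X, -, hX⟩ := zorn_subset_nonempty
      {X : Set (EuclideanSpace ℝ (Fin d)) | X.Pairwise fun x y => ρ ≤ dist x y}
      (fun c hc hchain _ => ⟨⋃₀ c, (Set.pairwise_sUnion hchain.directedOn).2 hc,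
        fun s hs => Set.subset_sUnion_of_mem hs⟩) ∅ (Set.pairwise_empty _)
    exact ⟨X, hX⟩
  refine ⟨X, Set.eq_univ_of_forall fun y => ?_, ?_⟩
  · -- Maximality: some point of `X` is within distance `ρ` of `y - p`.
    obtain ⟨x, hx, hxy⟩ : ∃ x ∈ X, dist (y - p) x < ρ := by
      by_contra! hfar
      have hmem : y - p ∈ X := hX.mem_of_prop_insert
        (hX.prop.insert fun b hb _ => ⟨hfar b hb, dist_comm b (y - p) ▸ hfar b hb⟩)
      have := hfar _ hmem
      rw [dist_self] at this
      linarith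
    refine Set.mem_iUnion₂.2 ⟨x, hx, y - x, hρK ?_, by simp⟩
    rw [Metric.mem_ball, dist_eq_norm] at *
    convert hxy using 2
    abel
  · have hb0 : volume (Metric.ball (0 : EuclideanSpace ℝ (Fin d)) (ρ / 2)) ≠ 0 :=
      (Metric.measure_ball_pos volume _ (by positivity)).ne'
    have hbt : volume (Metric.ball (0 : EuclideanSpace ℝ (Fin d)) (ρ / 2)) ≠ ∞ :=
      measure_ball_lt_top.ne
    set q := volume K / volume (Metric.ball (0 : EuclideanSpace ℝ (Fin d)) (ρ / 2)) with hq
    have hqt : q < ∞ := ENNReal.div_lt_top hK.measure_lt_top.ne hb0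
    have hdens : ∀ r, densityInBall K X r ≤ q := by
      intro r
      refine ENNReal.div_le_of_le_mul ?_
      set G := {x : EuclideanSpace ℝ (Fin d) | x ∈ X ∧ x +ᵥ K ⊆ Metric.closedBall 0 r}
      have hdisj : Pairwise (Function.onFun Disjoint
          fun x : G => Metric.ball (x.1 + p) (ρ / 2)) := by
        intro x y hxy
        refine Metric.ball_disjoint_ball ?_
        rw [dist_add_right, add_halves]
        exact hX.prop x.2.1 y.2.1 (Subtype.coe_injective.ne hxy)
      have hsub : ⋃ x : G, Metric.ball (x.1 + p) (ρ / 2) ⊆ Metric.closedBall 0 r := by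
        refine Set.iUnion_subset fun x => subset_trans ?_ x.2.2
        intro z hz
        refine ⟨z - x, hρK ?_, by simp⟩
        rw [Metric.mem_ball, dist_eq_norm] at *
        calc ‖z - x - p‖ = ‖z - (x + p)‖ := by congr 1; abel
          _ < ρ := hz.trans (by linarith)
      calc ∑' x : G, volume (x.1 +ᵥ K)
          = ∑' x : G, q * volume (Metric.ball (x.1 + p) (ρ / 2)) := by
            refine tsum_congr fun x => ?_
            rw [measure_vadd, Measure.addHaar_ball_center, hq, ENNReal.div_mul_cancel hb0 hbt]
        _ = q * ∑' x : G, volume (Metric.ball (x.1 + p) (ρ / 2)) := ENNReal.tsum_mul_left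
        _ ≤ q * volume (Metric.closedBall (0 : EuclideanSpace ℝ (Fin d)) r) := by
            gcongr
            exact (tsum_meas_le_meas_iUnion_of_disjoint volume
              (fun _ => Metric.isOpen_ball.measurableSet) hdisj).trans (measure_mono hsub)
    calc lowerDensity K X ≤ liminf (fun _ : ℝ => q) atTop :=
          liminf_le_liminf (Eventually.of_forall hdens)
      _ = q := liminf_const q
      _ < ∞ := hqt

/-! ### The main inequality -/

theorem theorem1 (d : ℕ) (K : ConvexBody (EuclideanSpace ℝ (Fin d)))
    (hK : (interior (K : Set (EuclideanSpace ℝ (Fin d)))).Nonempty) :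
    translativeCoveringDensity (K : Set (EuclideanSpace ℝ (Fin d))) < ∞ ∧
      coveringParam (K : Set (EuclideanSpace ℝ (Fin d))) <
        ENNReal.ofReal (Real.exp 1 * (d + 1)) *
          (volume ((K : Set (EuclideanSpace ℝ (Fin d))) - (K : Set (EuclideanSpace ℝ (Fin d)))) /
            volume (K : Set (EuclideanSpace ℝ (Fin d)))) *
          translativeCoveringDensity (K : Set (EuclideanSpace ℝ (Fin d))) := by
  have hc := K.isCompact
  have hcv := K.convex
  have hne := K.nonempty
  generalize (K : Set (EuclideanSpace ℝ (Fin d))) = L at *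
  have hfin : translativeCoveringDensity L < ∞ := by
    obtain ⟨X, hX, hlt⟩ := exists_isTranslativeCovering_lowerDensity_lt_top hc hK
    exact (iInf₂_le X hX).trans_lt hlt
  refine ⟨hfin, ?_⟩
  have hv0 : volume L ≠ 0 := 
    (Measure.measure_pos_of_nonempty_interior volume hK).ne'
  have hvt : volume L ≠ ∞ := hc.measure_lt_top.ne
  have hLL : IsCompact (L - L) := sub_eq_add_neg L L ▸ hc.add hc.neg
  obtain ⟨lam, h0, h1, hlam⟩ := exists_ratio_lt_exp_mul d
  have h1' : 0 < (1 - lam)⁻¹ := inv_pos.2 (by linarith)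
  have hC : 1 ≤ coveringParam L := one_le_coveringParam hne
  set q := volume (L - L) / volume L with hq
  have hqt : q ≠ ∞ := (ENNReal.div_lt_top hLL.measure_lt_top.ne hv0).ne
  set a := ENNReal.ofReal ((1 - lam)⁻¹ * lam⁻¹ ^ d) * q with ha
  have hat : a ≠ ∞ := ENNReal.mul_ne_top ENNReal.ofReal_ne_top hqt
  have hcov : ∀ X, IsTranslativeCovering L X → coveringParam L ≤ a * lowerDensity L X := by
    intro X hX
    rw [← ENNReal.mul_le_mul_iff_left hv0 hvt]
    calc coveringParam L * volume L
        ≤ ENNReal.ofReal (1 - lam)⁻¹ * volume (lam⁻¹ • L - L) * lowerDensity L X :=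
          coveringParam_mul_volume_le_lowerDensity hc hv0 hX h0 h1
      _ ≤ ENNReal.ofReal (1 - lam)⁻¹ * (ENNReal.ofReal (lam⁻¹ ^ d) * volume (L - L)) *
          lowerDensity L X := by
          gcongr
          exact volume_inv_smul_sub_le hcv hne h0 h1
      _ = ENNReal.ofReal ((1 - lam)⁻¹ * lam⁻¹ ^ d) * (q * volume L) * lowerDensity L X := by
          rw [hq, ENNReal.div_mul_cancel hv0 hvt, ENNReal.ofReal_mul h1'.le]
          ring
      _ = a * lowerDensity L X * volume L := by rw [ha]; ring
  have ha0 : a ≠ 0 := by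
    intro h
    obtain ⟨X, hX, -⟩ := exists_isTranslativeCovering_lowerDensity_lt_top hc hK
    have := hC.trans (hcov X hX)
    simp [h] at this
  have hmain : coveringParam L ≤ a * translativeCoveringDensity L := by
    rw [mul_comm, ← ENNReal.div_le_iff_le_mul (.inl ha0) (.inl hat)]
    exact le_iInf₂ fun X hX => ENNReal.div_le_of_le_mul' (hcov X hX)
  have hq0 : q * translativeCoveringDensity L ≠ 0 := by
    intro h
    rw [ha, mul_assoc, h, mul_zero] at hmain
    exact absurd (hC.trans hmain) (by simp)
  refine hmain.trans_lt ?_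
  rw [ha, mul_assoc, mul_assoc]
  exact ENNReal.mul_lt_mul_left hq0 (ENNReal.mul_ne_top hqt hfin.ne)
    ((ENNReal.ofReal_lt_ofReal_iff (by positivity)).2 hlam)
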